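/- Let $K$ be a field of characteristic $0$, let $q$ be an indeterminate, and let $\mathcal H_n(q)$ be the Hecke algebra of the symmetric group $\mathfrak S_n$ over $K(q)$, i.e. the $K(q)$-algebra with generators $T_1,\dots,T_{n-1}$ and relations $(T_i+1)(T_i-q)=0$, $T_iT_j=T_jT_i$ for $|i-j|\ge 2$, and $T_iT_{i+1}T_i=T_{i+1}T_iT_{i+1}$. For $w\in\mathfrak S_n$ put $T_w=T_{a_1}\cdots T_{a_r}$, where $w=s_{a_1}\cdots s_{a_r}$ is a reduced decomposition of $w$ into adjacent transpositions $s_i=(i,i+1)$, and let $E_i=\frac{1}{q+1}(q-1-2T_i)$. Then there are unique coefficients $c_w(q)\in K(q)$ with $$E_1E_2\cdots E_{n-1}\,E_1E_2\cdots E_{n-2}\cdots E_1E_2\,E_1=\sum_{w\in\mathfrak S_n}c_w(q)\,T_w .$$ For $w=a_1a_2\cdots a_n\in\mathfrak S_n$ let $\widehat w=a_n\cdots a_2a_1$ be its reversal, and let $\kappa(\widehat w)$ be the number of cycles of $\widehat w$ (fixed points included). Then for every $w\in\mathfrak S_n$ the coefficient $c_w(q)$ is divisible by $(q-1)^{n-\kappa(\widehat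 w)}$ in $K[q,(q+1)^{-1}]$; that is, $c_w(q)=(q-1)^{n-\kappa(\widehat w)}\,g(q)/(q+1)^N$ for some polynomial $g\in K[q]$ and some integer $N\ge 0$. -/

import Mathlib

open Equiv

/-- Defining relations of the Hecke algebra of the symmetric group on `n` letters with parameter
`q`, on generators `T_i`. The index `i : Fin (n - 1)` stands for the generator usually numbered
`i + 1`. -/
inductive HeckeRel (R : Type*) [CommRing R] (q : R) (n : ℕ) :
    FreeAlgebra R (Fin (n - 1)) → FreeAlgebra R (Fin (n - 1)) → Prop
  | quadratic (i : Fin (n - 1)) :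
      HeckeRel R q n
        ((FreeAlgebra.ι R i + 1) * (FreeAlgebra.ι R i - algebraMap R _ q)) 0
  | comm (i j : Fin (n - 1)) (h : (i : ℕ) + 2 ≤ j ∨ (j : ℕ) + 2 ≤ i) :
      HeckeRel R q n
        (FreeAlgebra.ι R i * FreeAlgebra.ι R j) (FreeAlgebra.ι R j * FreeAlgebra.ι R i)
  | braid (i j : Fin (n - 1)) (h : (j : ℕ) = i + 1) :
      HeckeRel R q n
        (FreeAlgebra.ι R i * FreeAlgebra.ι R j * FreeAlgebra.ι R i)
        (FreeAlgebra.ι R j * FreeAlgebra.ι R i * FreeAlgebra.ι R j)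

/-- The Hecke algebra `H_n(q)` over `R`, by generators and relations. -/
abbrev HeckeAlgebra (R : Type*) [CommRing R] (q : R) (n : ℕ) : Type _ :=
  RingQuot (HeckeRel R q n)

/-- The generator `T_i` of `H_n(q)`. -/
noncomputable def heckeGen {R : Type*} [CommRing R] (q : R) (n : ℕ) (i : Fin (n - 1)) :
    HeckeAlgebra R q n :=
  RingQuot.mkAlgHom R (HeckeRel R q n) (FreeAlgebra.ι R i)

/-- The adjacent transposition `s_i`, exchanging the consecutive letters `i` and `i + 1`
of `Fin n`. -/
def adjSwap (n : ℕ) (i : Fin (n - 1)) : Perm (Fin n) :=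
  swap ⟨i, by omega⟩ ⟨i + 1, by omega⟩

/-- `a` is a reduced decomposition of `w`: `w = s_{a_1} ⋯ s_{a_r}` with `r` as small as
possible. -/
def IsReducedDecomposition {n : ℕ} (w : Perm (Fin n)) (a : List (Fin (n - 1))) : Prop :=
  (a.map (adjSwap n)).prod = w ∧
    ∀ b : List (Fin (n - 1)), (b.map (adjSwap n)).prod = w → a.length ≤ b.length

theorem exists_adjSwap_word {n : ℕ} (w : Perm (Fin n)) :
    ∃ a : List (Fin (n - 1)), (a.map (adjSwap n)).prod = w := by
  cases n with
  | zero => exact ⟨[], Subsingleton.elim _ _⟩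
  | succ m =>
    have h : w ∈ Submonoid.closure
        (Set.range fun i : Fin m => swap i.castSucc i.succ) := by
      rw [Equiv.Perm.mclosure_swap_castSucc_succ]; trivial
    induction h using Submonoid.closure_induction with
    | mem x hx => obtain ⟨i, rfl⟩ := hx; exact ⟨[i], by simp [adjSwap]; rfl⟩
    | one => exact ⟨[], rfl⟩
    | mul x y _ _ hx hy =>
      obtain ⟨a, rfl⟩ := hx
      obtain ⟨b, rfl⟩ := hy
      exact ⟨a ++ b, by simp⟩

theorem exists_isReducedDecomposition {n : ℕ} (w : Perm (Fin n)) :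
    ∃ a : List (Fin (n - 1)), IsReducedDecomposition w a := by
  classical
  have h : ∃ r, ∃ a : List (Fin (n - 1)), a.length = r ∧ (a.map (adjSwap n)).prod = w := by
    obtain ⟨a, ha⟩ := exists_adjSwap_word w
    exact ⟨_, a, rfl, ha⟩
  obtain ⟨a, hl, ha⟩ := Nat.find_spec h
  exact ⟨a, ha, fun b hb => hl ▸ Nat.find_min' h ⟨b, rfl, hb⟩⟩

/-- The standard basis element `T_w = T_{a_1} ⋯ T_{a_r}`, for a reduced decomposition
`(a_1, …, a_r)` of `w`; by a standard fact the choice of the decomposition does not matter. -/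
noncomputable def heckeT {R : Type*} [CommRing R] (q : R) {n : ℕ} (w : Perm (Fin n)) :
    HeckeAlgebra R q n :=
  ((exists_isReducedDecomposition w).choose.map (heckeGen q n)).prod

/-- `E_i = (q - 1 - 2 T_i) / (q + 1)`. -/
noncomputable def heckeE {F : Type*} [Field F] (q : F) (n : ℕ) (i : Fin (n - 1)) :
    HeckeAlgebra F q n :=
  (q + 1)⁻¹ • (algebraMap F (HeckeAlgebra F q n) (q - 1) - 2 * heckeGen q n i)

/-- The sequence `1, 2, …, n-1, 1, 2, …, n-2, …, 1, 2, 1` (with letters shifted down by one). -/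
def evacWord (n : ℕ) : List (Fin (n - 1)) :=
  (List.finRange (n - 1)).flatMap fun j => (List.finRange (n - 1)).take (n - 1 - j)

/-- The product `E_1 E_2 ⋯ E_{n-1} E_1 E_2 ⋯ E_{n-2} ⋯ E_1 E_2 E_1`. -/
noncomputable def evacProduct {F : Type*} [Field F] (q : F) (n : ℕ) : HeckeAlgebra F q n :=
  ((evacWord n).map (heckeE q n)).prod

/-- `c` is a family of coefficients of the product above in terms of the elements `T_w`. -/
def IsEvacExpansion {F : Type*} [Field F] (q : F) (n : ℕ) (c : Perm (Fin n) → F) : Prop :=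
  evacProduct q n = ∑ w : Perm (Fin n), c w • heckeT q w

/-- The reversal of `w = a_1 a_2 ⋯ a_n` is `a_n ⋯ a_2 a_1`, i.e. `i ↦ w (n + 1 - i)`. It is the
product of `w` and the longest permutation `w_0` in which `w_0` acts first. -/
def reversal {n : ℕ} (w : Perm (Fin n)) : Perm (Fin n) :=
  Fin.revPerm.trans w

/-- The number of cycles of a permutation, fixed points counted as cycles. -/
def numCycles {n : ℕ} (w : Perm (Fin n)) : ℕ :=
  w.cycleType.card + (Finset.univ.filter fun i => w i = i).card

/-! At `q = 1` each `E_i` specializes to `-s_i`, so a product of the `E_i` along a word specializes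
to `± v`, where `v` is the product of the corresponding transpositions `s_i`. The divisibility
refines this. Up to the denominator `q + 1`, each factor `E_i` multiplies by a combination of
`q - 1` and `T_i`, while `v` is multiplied by `s_i`. Multiplication of a permutation by one
transposition changes its number of cycles by at most one, so if the coefficient of each `T_w` is
divisible by `(q - 1) ^ (n - κ(w⁻¹ v))`, then a factor `q - 1` pays for the replacement of `v` by
`s_i v`, and multiplication by `T_i`, which moves `T_w` to `T_{s_i w}` up to a multiple of
`(q - 1) T_w`, preserves the divisibility since `(s_i w)⁻¹ s_i v = w⁻¹ v`. For the word of the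
theorem `v` is the longest permutation `w₀`, and `w⁻¹ w₀` is conjugate to the inverse of the
reversal `w w₀` of `w`.

That the `T_w` form a basis is seen by letting the Hecke algebra act on functions on the symmetric
group by the formulas which left multiplication by the `T_i` has to satisfy. -/

section Inversions

variable {n : ℕ}

/-- The smaller of the two letters exchanged by `adjSwap n i`. -/
def adjLo (i : Fin (n - 1)) : Fin n := ⟨i, by omega⟩

/-- The larger of the two letters exchanged by `adjSwap n i`. -/
def adjHi (i : Fin (n - 1)) : Fin n := ⟨i + 1, by omega⟩

theorem adjLo_lt_adjHi (i : Fin (n - 1)) : adjLo i < adjHi i := Nat.lt_succ_self i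

theorem adjLo_eq_adjHi {i j : Fin (n - 1)} (h : (j : ℕ) = i + 1) : adjLo j = adjHi i :=
  Fin.ext h

@[simp] theorem adjSwap_adjLo (i : Fin (n - 1)) : adjSwap n i (adjLo i) = adjHi i :=
  swap_apply_left _ _

@[simp] theorem adjSwap_adjHi (i : Fin (n - 1)) : adjSwap n i (adjHi i) = adjLo i :=
  swap_apply_right _ _

theorem adjSwap_val (i : Fin (n - 1)) (x : Fin n) :
    (adjSwap n i x : ℕ) =
      if (x : ℕ) = i then (i : ℕ) + 1 else if (x : ℕ) = i + 1 then (i : ℕ) else x := by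
  rw [adjSwap, swap_apply_def]
  simp only [Fin.ext_iff]
  split_ifs <;> rfl

theorem adjSwap_succ_adjLo {i j : Fin (n - 1)} (h : (j : ℕ) = i + 1) :
    adjSwap n j (adjLo i) = adjLo i := by
  simp only [Fin.ext_iff, adjSwap_val, adjLo]
  split_ifs <;> omega

theorem adjSwap_adjHi_succ {i j : Fin (n - 1)} (h : (j : ℕ) = i + 1) :
    adjSwap n i (adjHi j) = adjHi j := by
  simp only [Fin.ext_iff, adjSwap_val, adjHi]
  split_ifs <;> omega

@[simp] theorem adjSwap_inv (i : Fin (n - 1)) : (adjSwap n i)⁻¹ = adjSwap n i :=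
  swap_inv _ _

@[simp] theorem adjSwap_mul_cancel (i : Fin (n - 1)) (w : Perm (Fin n)) :
    adjSwap n i * (adjSwap n i * w) = w :=
  swap_mul_self_mul _ _ w

theorem adjSwap_left_comm {i j : Fin (n - 1)} (h : (i : ℕ) + 2 ≤ j) (w : Perm (Fin n)) :
    adjSwap n i * (adjSwap n j * w) = adjSwap n j * (adjSwap n i * w) := by
  ext x
  simp only [Perm.mul_apply, adjSwap_val]
  split_ifs <;> omega

theorem adjSwap_braid {i j : Fin (n - 1)} (h : (j : ℕ) = i + 1) :
    adjSwap n i * adjSwap n j * adjSwap n i = adjSwap n j * adjSwap n i * adjSwap n j := by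
  have hi := adjLo_lt_adjHi i
  have hj := adjLo_lt_adjHi j
  change swap (adjLo i) (adjHi i) * swap (adjLo j) (adjHi j) * swap (adjLo i) (adjHi i) =
    swap (adjLo j) (adjHi j) * swap (adjLo i) (adjHi i) * swap (adjLo j) (adjHi j)
  rw [adjLo_eq_adjHi h] at hj ⊢
  rw [swap_mul_swap_mul_swap hi.ne (hi.trans hj).ne, swap_comm (adjLo i) (adjHi i),
    swap_comm (adjHi i) (adjHi j), swap_mul_swap_mul_swap hj.ne' (hi.trans hj).ne', swap_comm]

theorem adjSwap_braid_mul {i j : Fin (n - 1)} (h : (j : ℕ) = i + 1) (w : Perm (Fin n)) :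
    adjSwap n i * (adjSwap n j * (adjSwap n i * w)) =
      adjSwap n j * (adjSwap n i * (adjSwap n j * w)) := by
  simpa only [mul_assoc] using congrArg (· * w) (adjSwap_braid h)

theorem inv_adjSwap_mul_apply (i : Fin (n - 1)) (w : Perm (Fin n)) (x : Fin n) :
    (adjSwap n i * w)⁻¹ x = w⁻¹ (adjSwap n i x) := by
  rw [mul_inv_rev, adjSwap_inv, Perm.mul_apply]

/-- `i` is a left descent of `w`: the letter `i + 1` occurs before the letter `i` in the word
`w 0, w 1, …` of `w`. -/
def IsLeftDescent (w : Perm (Fin n)) (i : Fin (n - 1)) : Prop :=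
  w⁻¹ (adjHi i) < w⁻¹ (adjLo i)

instance (w : Perm (Fin n)) (i : Fin (n - 1)) : Decidable (IsLeftDescent w i) :=
  inferInstanceAs (Decidable (_ < _))

theorem not_isLeftDescent_iff {w : Perm (Fin n)} {i : Fin (n - 1)} :
    ¬ IsLeftDescent w i ↔ w⁻¹ (adjLo i) < w⁻¹ (adjHi i) :=
  not_lt.trans (w⁻¹.injective.ne (adjLo_lt_adjHi i).ne).le_iff_lt

theorem isLeftDescent_adjSwap_mul {w : Perm (Fin n)} {i : Fin (n - 1)} :
    IsLeftDescent (adjSwap n i * w) i ↔ ¬ IsLeftDescent w i := by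
  rw [not_isLeftDescent_iff, IsLeftDescent, inv_adjSwap_mul_apply, inv_adjSwap_mul_apply,
    adjSwap_adjLo, adjSwap_adjHi]

theorem isLeftDescent_adjSwap_mul_of_far {w : Perm (Fin n)} {i j : Fin (n - 1)}
    (h : (i : ℕ) + 2 ≤ j ∨ (j : ℕ) + 2 ≤ i) :
    IsLeftDescent (adjSwap n i * w) j ↔ IsLeftDescent w j := by
  have hHi : adjSwap n i (adjHi j) = adjHi j := by
    simp only [Fin.ext_iff, adjSwap_val, adjHi]
    split_ifs <;> omega
  have hLo : adjSwap n i (adjLo j) = adjLo j := by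
    simp only [Fin.ext_iff, adjSwap_val, adjLo]
    split_ifs <;> omega
  rw [IsLeftDescent, inv_adjSwap_mul_apply, inv_adjSwap_mul_apply, hHi, hLo, IsLeftDescent]

theorem eq_one_of_forall_not_isLeftDescent {w : Perm (Fin n)} (h : ∀ i, ¬ IsLeftDescent w i) :
    w = 1 := by
  cases n with
  | zero => exact Subsingleton.elim _ _
  | succ m =>
    have hmono : StrictMono (w⁻¹ : Perm (Fin (m + 1))) :=
      Fin.strictMono_iff_lt_succ.2 fun i => not_isLeftDescent_iff.1 (h i)
    have hid : ⇑w⁻¹ = id :=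
      (hmono.range_inj strictMono_id).1 (w⁻¹.surjective.range_eq.trans Set.range_id.symm)
    exact inv_eq_one.1 (Equiv.ext (congrFun hid))

/-- The pairs of letters `x < y` such that `y` occurs before `x` in the word of `w`. -/
def inversionSet (w : Perm (Fin n)) : Finset (Fin n × Fin n) :=
  Finset.univ.filter fun p => p.1 < p.2 ∧ w⁻¹ p.2 < w⁻¹ p.1

/-- The number of inversions of `w`, which is its Coxeter length. -/
def inversionNumber (w : Perm (Fin n)) : ℕ := (inversionSet w).card

theorem mem_inversionSet {w : Perm (Fin n)} {x y : Fin n} :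
    (x, y) ∈ inversionSet w ↔ x < y ∧ w⁻¹ y < w⁻¹ x := by
  simp only [inversionSet, Finset.mem_filter, Finset.mem_univ, true_and]

theorem mem_map_adjSwap_inversionSet {w : Perm (Fin n)} {i : Fin (n - 1)} {x y : Fin n} :
    (x, y) ∈ (inversionSet w).map ((adjSwap n i).prodCongr (adjSwap n i)).toEmbedding ↔
      adjSwap n i x < adjSwap n i y ∧ w⁻¹ (adjSwap n i y) < w⁻¹ (adjSwap n i x) := by
  have hsymm : (adjSwap n i).symm = adjSwap n i := adjSwap_inv i
  rw [Finset.mem_map_equiv, prodCongr_symm, hsymm, prodCongr_apply, Prod.map_apply,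
    mem_inversionSet]

theorem inversionSet_adjSwap_mul {w : Perm (Fin n)} {i : Fin (n - 1)} (h : ¬ IsLeftDescent w i) :
    inversionSet (adjSwap n i * w) = insert (adjLo i, adjHi i)
      ((inversionSet w).map ((adjSwap n i).prodCongr (adjSwap n i)).toEmbedding) := by
  ext ⟨x, y⟩
  rw [Finset.mem_insert, mem_map_adjSwap_inversionSet, mem_inversionSet, inv_adjSwap_mul_apply,
    inv_adjSwap_mul_apply, Prod.mk.injEq]
  by_cases hxy : x = adjLo i ∧ y = adjHi i
  · obtain ⟨rfl, rfl⟩ := hxy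
    simpa [adjLo_lt_adjHi] using not_isLeftDescent_iff.1 h
  by_cases hyx : x = adjHi i ∧ y = adjLo i
  · obtain ⟨rfl, rfl⟩ := hyx
    simpa [(adjLo_lt_adjHi i).ne', (adjLo_lt_adjHi i).asymm] using fun _ => not_lt.1 h
  · have hlt : adjSwap n i x < adjSwap n i y ↔ x < y := by
      simp only [adjLo, adjHi, Fin.ext_iff] at hxy hyx
      simp only [Fin.lt_def, adjSwap_val]
      split_ifs <;> omega
    rw [hlt, or_iff_right hxy]

theorem inversionNumber_adjSwap_mul {w : Perm (Fin n)} {i : Fin (n - 1)}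
    (h : ¬ IsLeftDescent w i) :
    inversionNumber (adjSwap n i * w) = inversionNumber w + 1 := by
  rw [inversionNumber, inversionSet_adjSwap_mul h, Finset.card_insert_of_notMem, Finset.card_map,
    inversionNumber]
  rw [mem_map_adjSwap_inversionSet, adjSwap_adjLo, adjSwap_adjHi]
  exact fun hmem => (adjLo_lt_adjHi i).asymm hmem.1

theorem inversionNumber_adjSwap_mul_add_one {w : Perm (Fin n)} {i : Fin (n - 1)}
    (h : IsLeftDescent w i) :
    inversionNumber (adjSwap n i * w) + 1 = inversionNumber w := by
  rw [← inversionNumber_adjSwap_mul (isLeftDescent_adjSwap_mul.not_left.2 h), adjSwap_mul_cancel]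

theorem inversionNumber_one : inversionNumber (1 : Perm (Fin n)) = 0 := by
  rw [inversionNumber, Finset.card_eq_zero, inversionSet, Finset.filter_eq_empty_iff]
  exact fun _ _ h => h.1.asymm h.2

theorem inversionNumber_prod_le (a : List (Fin (n - 1))) :
    inversionNumber (a.map (adjSwap n)).prod ≤ a.length := by
  induction a with
  | nil => exact inversionNumber_one.le
  | cons i a ih =>
    rw [List.map_cons, List.prod_cons, List.length_cons]
    by_cases h : IsLeftDescent (a.map (adjSwap n)).prod i
    · have := inversionNumber_adjSwap_mul_add_one h
      omega
    · rw [inversionNumber_adjSwap_mul h]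
      omega

theorem exists_word_length_eq_inversionNumber (w : Perm (Fin n)) :
    ∃ a : List (Fin (n - 1)), (a.map (adjSwap n)).prod = w ∧ a.length = inversionNumber w := by
  induction hk : inversionNumber w generalizing w with
  | zero =>
    refine ⟨[], (eq_one_of_forall_not_isLeftDescent fun i hi => ?_).symm, rfl⟩
    have := inversionNumber_adjSwap_mul_add_one hi
    omega
  | succ k ih =>
    obtain ⟨i, hi⟩ : ∃ i, IsLeftDescent w i := by
      by_contra! hne
      rw [eq_one_of_forall_not_isLeftDescent hne, inversionNumber_one] at hk
      omega
    have hlen := inversionNumber_adjSwap_mul_add_one hi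
    obtain ⟨a, ha, hl⟩ := ih (adjSwap n i * w) (by omega)
    exact ⟨i :: a, by simp [ha], by simp [hl]⟩

theorem isReducedDecomposition_iff {w : Perm (Fin n)} {a : List (Fin (n - 1))} :
    IsReducedDecomposition w a ↔
      (a.map (adjSwap n)).prod = w ∧ a.length = inversionNumber w := by
  refine and_congr_right fun ha => ⟨fun hmin => ?_, fun hl b hb => ?_⟩
  · obtain ⟨b, hb, hl⟩ := exists_word_length_eq_inversionNumber w
    exact le_antisymm (hl ▸ hmin b hb) (ha ▸ inversionNumber_prod_le a)
  · exact hl.trans_le (hb ▸ inversionNumber_prod_le b)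

theorem isReducedDecomposition_one_nil :
    IsReducedDecomposition (1 : Perm (Fin n)) [] :=
  ⟨rfl, fun _ _ => Nat.zero_le _⟩

theorem isReducedDecomposition_cons {w : Perm (Fin n)} {i : Fin (n - 1)}
    {a : List (Fin (n - 1))} :
    IsReducedDecomposition w (i :: a) ↔
      IsLeftDescent w i ∧ IsReducedDecomposition (adjSwap n i * w) a := by
  simp only [isReducedDecomposition_iff, List.map_cons, List.prod_cons, List.length_cons]
  constructor
  · rintro ⟨rfl, hl⟩
    have hi : IsLeftDescent (adjSwap n i * (a.map (adjSwap n)).prod) i := by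
      by_contra hi
      have hup := inversionNumber_adjSwap_mul hi
      rw [adjSwap_mul_cancel] at hup
      have := inversionNumber_prod_le a
      omega
    have hdown := inversionNumber_adjSwap_mul_add_one hi
    exact ⟨hi, (adjSwap_mul_cancel _ _).symm, by omega⟩
  · rintro ⟨hi, ha, hl⟩
    rw [ha, adjSwap_mul_cancel, hl]
    exact ⟨rfl, inversionNumber_adjSwap_mul_add_one hi⟩

end Inversions

section Matsumoto

variable {n : ℕ} {M : Type*} [Monoid M]

/-- The family `f` satisfies the braid relations of the symmetric group on `n` letters. -/
structure IsBraidFamily (f : Fin (n - 1) → M) : Prop where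
  comm : ∀ i j : Fin (n - 1), (i : ℕ) + 2 ≤ j → f i * f j = f j * f i
  braid : ∀ i j : Fin (n - 1), (j : ℕ) = i + 1 → f i * f j * f i = f j * f i * f j

theorem IsBraidFamily.exists_reduced_of_far {f : Fin (n - 1) → M} (hf : IsBraidFamily f)
    {w : Perm (Fin n)} {i j : Fin (n - 1)} (h : (i : ℕ) + 2 ≤ j) (hi : IsLeftDescent w i)
    (hj : IsLeftDescent w j) :
    ∃ c d, IsReducedDecomposition (adjSwap n i * w) c ∧
      IsReducedDecomposition (adjSwap n j * w) d ∧
      f i * (c.map f).prod = f j * (d.map f).prod := by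
  obtain ⟨e, he⟩ := exists_isReducedDecomposition (adjSwap n j * (adjSwap n i * w))
  refine ⟨j :: e, i :: e, isReducedDecomposition_cons.2 ⟨?_, he⟩,
    isReducedDecomposition_cons.2 ⟨?_, adjSwap_left_comm h w ▸ he⟩, ?_⟩
  · exact (isLeftDescent_adjSwap_mul_of_far (.inl h)).2 hj
  · exact (isLeftDescent_adjSwap_mul_of_far (.inr h)).2 hi
  · simp only [List.map_cons, List.prod_cons, ← mul_assoc, hf.comm i j h]

theorem IsBraidFamily.exists_reduced_of_succ {f : Fin (n - 1) → M} (hf : IsBraidFamily f)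
    {w : Perm (Fin n)} {i j : Fin (n - 1)} (h : (j : ℕ) = i + 1) (hi : IsLeftDescent w i)
    (hj : IsLeftDescent w j) :
    ∃ c d, IsReducedDecomposition (adjSwap n i * w) c ∧
      IsReducedDecomposition (adjSwap n j * w) d ∧
      f i * (c.map f).prod = f j * (d.map f).prod := by
  obtain ⟨e, he⟩ :=
    exists_isReducedDecomposition (adjSwap n i * (adjSwap n j * (adjSwap n i * w)))
  have he' := adjSwap_braid_mul h w ▸ he
  have hlo := adjLo_eq_adjHi h
  have hjHi : adjSwap n j (adjHi i) = adjHi j := by rw [← hlo, adjSwap_adjLo]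
  refine ⟨j :: i :: e, i :: j :: e, ?_, ?_, ?_⟩
  · simp only [isReducedDecomposition_cons, he, and_true, IsLeftDescent, inv_adjSwap_mul_apply,
      adjSwap_succ_adjLo h, adjSwap_adjHi_succ h, hlo, hjHi, adjSwap_adjLo, adjSwap_adjHi]
      at hi hj ⊢
    exact ⟨hj.trans hi, hj⟩
  · simp only [isReducedDecomposition_cons, he', and_true, IsLeftDescent, inv_adjSwap_mul_apply,
      adjSwap_succ_adjLo h, adjSwap_adjHi_succ h, hlo, hjHi, adjSwap_adjHi] at hi hj ⊢
    exact ⟨hj.trans hi, hi⟩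
  · simp only [List.map_cons, List.prod_cons, ← mul_assoc, hf.braid i j h]

theorem IsBraidFamily.exists_reduced_of_isLeftDescent {f : Fin (n - 1) → M}
    (hf : IsBraidFamily f) {w : Perm (Fin n)} {i j : Fin (n - 1)} (hi : IsLeftDescent w i)
    (hj : IsLeftDescent w j) :
    ∃ c d, IsReducedDecomposition (adjSwap n i * w) c ∧
      IsReducedDecomposition (adjSwap n j * w) d ∧
      f i * (c.map f).prod = f j * (d.map f).prod := by
  wlog hij : i ≤ j generalizing i j
  · obtain ⟨c, d, hc, hd, hcd⟩ := this hj hi (le_of_not_ge hij)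
    exact ⟨d, c, hd, hc, hcd.symm⟩
  obtain h | h | h : (i : ℕ) = j ∨ (j : ℕ) = i + 1 ∨ (i : ℕ) + 2 ≤ j := by
    have := Fin.le_def.1 hij
    omega
  · obtain rfl : i = j := Fin.ext h
    obtain ⟨c, hc⟩ := exists_isReducedDecomposition (adjSwap n i * w)
    exact ⟨c, c, hc, hc, rfl⟩
  · exact hf.exists_reduced_of_succ h hi hj
  · exact hf.exists_reduced_of_far h hi hj

/-- Matsumoto's theorem for the symmetric group. -/
theorem IsBraidFamily.prod_eq_of_isReducedDecomposition {f : Fin (n - 1) → M}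
    (hf : IsBraidFamily f) {w : Perm (Fin n)} {a b : List (Fin (n - 1))}
    (ha : IsReducedDecomposition w a) (hb : IsReducedDecomposition w b) :
    (a.map f).prod = (b.map f).prod := by
  induction hk : a.length generalizing w a b with
  | zero =>
    have hba : b.length ≤ a.length := hb.2 a ha.1
    rw [List.length_eq_zero_iff.1 hk, List.length_eq_zero_iff.1 (by omega : b.length = 0)]
  | succ k ih =>
    have hbk : b.length = k + 1 := hk ▸ le_antisymm (hb.2 a ha.1) (ha.2 b hb.1)
    obtain ⟨i, a, rfl⟩ := List.exists_cons_of_length_eq_add_one hk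
    obtain ⟨j, b, rfl⟩ := List.exists_cons_of_length_eq_add_one hbk
    rw [List.length_cons, Nat.add_right_cancel_iff] at hk hbk
    rw [isReducedDecomposition_cons] at ha hb
    obtain ⟨c, d, hc, hd, hcd⟩ := hf.exists_reduced_of_isLeftDescent ha.1 hb.1
    rw [List.map_cons, List.prod_cons, List.map_cons, List.prod_cons, ih ha.2 hc hk,
      ih hb.2 hd hbk, hcd]

end Matsumoto

section HeckeFamily

variable {R : Type*} [CommRing R] {q : R} {n : ℕ} {A : Type*} [Ring A] [Algebra R A]

/-- The family `t` satisfies the defining relations of the Hecke algebra with parameter `q`. -/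
structure IsHeckeFamily (q : R) (t : Fin (n - 1) → A) : Prop extends IsBraidFamily t where
  quadratic : ∀ i, (t i + 1) * (t i - algebraMap R A q) = 0

theorem IsHeckeFamily.mul_self {t : Fin (n - 1) → A} (ht : IsHeckeFamily q t)
    (i : Fin (n - 1)) : t i * t i = (q - 1) • t i + q • 1 := by
  have h := ht.quadratic i
  rw [Algebra.algebraMap_eq_smul_one, add_mul, mul_sub, mul_sub, one_mul, one_mul,
    mul_smul_comm, mul_one] at h
  rw [← sub_eq_zero, ← h, sub_smul, one_smul]
  abel

theorem isHeckeFamily_heckeGen : IsHeckeFamily q (heckeGen q n) where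
  comm i j h := by
    simpa only [heckeGen, map_mul] using
      RingQuot.mkAlgHom_rel R (HeckeRel.comm (q := q) i j (.inl h))
  braid i j h := by
    simpa only [heckeGen, map_mul] using RingQuot.mkAlgHom_rel R (HeckeRel.braid (q := q) i j h)
  quadratic i := by
    simpa only [heckeGen, map_mul, map_add, map_sub, map_one, map_zero, AlgHom.commutes] using
      RingQuot.mkAlgHom_rel R (HeckeRel.quadratic (q := q) (n := n) i)

/-- The algebra homomorphism out of the Hecke algebra which sends `T_i` to `t i`. -/
noncomputable def IsHeckeFamily.lift {t : Fin (n - 1) → A} (ht : IsHeckeFamily q t) :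
    HeckeAlgebra R q n →ₐ[R] A :=
  RingQuot.liftAlgHom R ⟨FreeAlgebra.lift R t, fun x y hxy => by
    cases hxy with
    | quadratic i => simpa using ht.quadratic i
    | comm i j h =>
      obtain h | h := h
      · simpa using ht.comm i j h
      · simpa using (ht.comm j i h).symm
    | braid i j h => simpa using ht.braid i j h⟩

theorem IsHeckeFamily.lift_heckeGen {t : Fin (n - 1) → A} (ht : IsHeckeFamily q t)
    (i : Fin (n - 1)) : ht.lift (heckeGen q n i) = t i := by
  rw [lift, heckeGen, RingQuot.liftAlgHom_mkAlgHom_apply, FreeAlgebra.lift_ι_apply]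

theorem HeckeAlgebra.induction {motive : HeckeAlgebra R q n → Prop}
    (algebraMap : ∀ r, motive (algebraMap R _ r)) (heckeGen : ∀ i, motive (heckeGen q n i))
    (mul : ∀ x y, motive x → motive y → motive (x * y))
    (add : ∀ x y, motive x → motive y → motive (x + y)) (x : HeckeAlgebra R q n) : motive x := by
  obtain ⟨y, rfl⟩ := RingQuot.mkAlgHom_surjective R (HeckeRel R q n) x
  induction y using FreeAlgebra.induction with
  | grade0 r => rw [AlgHom.commutes]; exact algebraMap r
  | grade1 i => exact heckeGen i
  | mul y z hy hz => rw [map_mul]; exact mul _ _ hy hz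
  | add y z hy hz => rw [map_add]; exact add _ _ hy hz

end HeckeFamily

section StandardBasis

variable {R : Type*} [CommRing R] (q : R) {n : ℕ}

theorem heckeT_eq_prod {w : Perm (Fin n)} {a : List (Fin (n - 1))}
    (ha : IsReducedDecomposition w a) : heckeT q w = (a.map (heckeGen q n)).prod :=
  isHeckeFamily_heckeGen.prod_eq_of_isReducedDecomposition
    (exists_isReducedDecomposition w).choose_spec ha

theorem heckeT_one : heckeT q (1 : Perm (Fin n)) = 1 :=
  heckeT_eq_prod q isReducedDecomposition_one_nil

theorem heckeGen_mul_heckeT_of_not_isLeftDescent {w : Perm (Fin n)} {i : Fin (n - 1)}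
    (h : ¬ IsLeftDescent w i) : heckeGen q n i * heckeT q w = heckeT q (adjSwap n i * w) := by
  obtain ⟨a, ha⟩ := exists_isReducedDecomposition w
  have hia : IsReducedDecomposition (adjSwap n i * w) (i :: a) :=
    isReducedDecomposition_cons.2 ⟨isLeftDescent_adjSwap_mul.2 h, by rwa [adjSwap_mul_cancel]⟩
  rw [heckeT_eq_prod q ha, heckeT_eq_prod q hia, List.map_cons, List.prod_cons]

theorem heckeGen_mul_heckeT_of_isLeftDescent {w : Perm (Fin n)} {i : Fin (n - 1)}
    (h : IsLeftDescent w i) : heckeGen q n i * heckeT q w =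
      (q - 1) • heckeT q w + q • heckeT q (adjSwap n i * w) := by
  have hw : heckeGen q n i * heckeT q (adjSwap n i * w) = heckeT q w := by
    rw [heckeGen_mul_heckeT_of_not_isLeftDescent q (isLeftDescent_adjSwap_mul.not_left.2 h),
      adjSwap_mul_cancel]
  rw [← hw, ← mul_assoc, isHeckeFamily_heckeGen.mul_self, add_mul, smul_mul_assoc,
    smul_mul_assoc, one_mul]

/-- The operator on coefficient functions `c` which multiplication of `∑ w, c w • T_w` by `T_i`
from the left induces. -/
def heckeOp (i : Fin (n - 1)) : Module.End R (Perm (Fin n) → R) where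
  toFun c w :=
    if IsLeftDescent w i then c (adjSwap n i * w) + (q - 1) * c w else q * c (adjSwap n i * w)
  map_add' c d := by
    ext w; simp only [Pi.add_apply]; split_ifs <;> ring
  map_smul' r c := by
    ext w; simp only [Pi.smul_apply, smul_eq_mul, RingHom.id_apply]; split_ifs <;> ring

theorem heckeOp_apply (i : Fin (n - 1)) (c : Perm (Fin n) → R) (w : Perm (Fin n)) :
    heckeOp q i c w =
      if IsLeftDescent w i then c (adjSwap n i * w) + (q - 1) * c w
      else q * c (adjSwap n i * w) := rfl

theorem heckeOp_quadratic (i : Fin (n - 1)) :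
    (heckeOp q i + 1) * (heckeOp q i - algebraMap R (Module.End R (Perm (Fin n) → R)) q) = 0 := by
  refine LinearMap.ext fun c => funext fun w => ?_
  simp only [Module.End.mul_apply, LinearMap.add_apply, LinearMap.sub_apply, Module.End.one_apply,
    Module.algebraMap_end_apply, LinearMap.zero_apply, Pi.add_apply, Pi.sub_apply, Pi.zero_apply,
    Pi.smul_apply, heckeOp_apply, isLeftDescent_adjSwap_mul, adjSwap_mul_cancel, smul_eq_mul]
  split_ifs <;> first | contradiction | ring

theorem heckeOp_comm {i j : Fin (n - 1)} (h : (i : ℕ) + 2 ≤ j) :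
    heckeOp q i * heckeOp q j = heckeOp q j * heckeOp q i := by
  refine LinearMap.ext fun c => funext fun w => ?_
  simp only [Module.End.mul_apply, heckeOp_apply, isLeftDescent_adjSwap_mul_of_far (.inl h),
    isLeftDescent_adjSwap_mul_of_far (.inr h), adjSwap_left_comm h]
  split_ifs <;> ring

theorem heckeOp_braid {i j : Fin (n - 1)} (h : (j : ℕ) = i + 1) :
    heckeOp q i * heckeOp q j * heckeOp q i = heckeOp q j * heckeOp q i * heckeOp q j := by
  refine LinearMap.ext fun c => funext fun w => ?_
  have hlo := adjLo_eq_adjHi h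
  have hjHi : adjSwap n j (adjHi i) = adjHi j := by rw [← hlo, adjSwap_adjLo]
  have hlt := adjLo_lt_adjHi i
  have hlt' : adjHi i < adjHi j := hlo ▸ adjLo_lt_adjHi j
  have not_lt_iff {x y : Fin n} (hxy : x < y) : w⁻¹ x < w⁻¹ y ↔ ¬ w⁻¹ y < w⁻¹ x :=
    (not_lt.trans (w⁻¹.injective.ne hxy.ne).le_iff_lt).symm
  simp only [Module.End.mul_apply, heckeOp_apply, IsLeftDescent, inv_adjSwap_mul_apply, hlo,
    adjSwap_adjLo, adjSwap_adjHi, adjSwap_adjHi_succ h, adjSwap_succ_adjLo h, hjHi,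
    adjSwap_mul_cancel, ← adjSwap_braid_mul h, not_lt_iff hlt, not_lt_iff hlt',
    ite_not]
  by_cases h₁ : w⁻¹ (adjHi i) < w⁻¹ (adjLo i) <;> by_cases h₂ : w⁻¹ (adjHi j) < w⁻¹ (adjHi i) <;>
    by_cases h₃ : w⁻¹ (adjHi j) < w⁻¹ (adjLo i) <;>
    first | (exfalso; order) | (simp only [h₁, h₂, h₃, if_true, if_false] <;> ring1)

theorem isHeckeFamily_heckeOp : IsHeckeFamily q (heckeOp q (n := n)) where
  comm _ _ h := heckeOp_comm q h
  braid _ _ h := heckeOp_braid q h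
  quadratic := heckeOp_quadratic q

/-- The regular representation of the Hecke algebra, in terms of coefficient functions. -/
noncomputable def heckeRep : HeckeAlgebra R q n →ₐ[R] Module.End R (Perm (Fin n) → R) :=
  (isHeckeFamily_heckeOp q).lift

theorem heckeRep_heckeGen (i : Fin (n - 1)) : heckeRep q (heckeGen q n i) = heckeOp q i :=
  (isHeckeFamily_heckeOp q).lift_heckeGen i

theorem heckeOp_single_of_not_isLeftDescent {w : Perm (Fin n)} {i : Fin (n - 1)}
    (h : ¬ IsLeftDescent w i) :
    heckeOp q i (Pi.single w 1) = Pi.single (adjSwap n i * w) 1 := by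
  funext u
  rw [heckeOp_apply]
  by_cases hu : u = adjSwap n i * w
  · subst hu
    have hne : adjSwap n i * w ≠ w := fun e => iff_not_self (e ▸ isLeftDescent_adjSwap_mul)
    rw [if_pos (isLeftDescent_adjSwap_mul.2 h), adjSwap_mul_cancel, Pi.single_eq_same,
      Pi.single_eq_same, Pi.single_eq_of_ne hne, mul_zero, add_zero]
  · have hu' : adjSwap n i * u ≠ w := fun e => hu (by rw [← e, adjSwap_mul_cancel])
    rw [Pi.single_eq_of_ne hu, Pi.single_eq_of_ne hu', mul_zero, ite_eq_right_iff, zero_add]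
    intro hd
    rw [Pi.single_eq_of_ne (by rintro rfl; exact h hd), mul_zero]

theorem heckeOp_single_of_isLeftDescent {w : Perm (Fin n)} {i : Fin (n - 1)}
    (h : IsLeftDescent w i) : heckeOp q i (Pi.single w 1) =
      (q - 1) • Pi.single w 1 + q • Pi.single (adjSwap n i * w) 1 := by
  have hw : heckeOp q i (Pi.single (adjSwap n i * w) 1) = Pi.single w 1 := by
    rw [heckeOp_single_of_not_isLeftDescent q (isLeftDescent_adjSwap_mul.not_left.2 h),
      adjSwap_mul_cancel]
  rw [← hw, ← Module.End.mul_apply, (isHeckeFamily_heckeOp q).mul_self]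
  rfl

theorem heckeRep_heckeT_single_one (w : Perm (Fin n)) :
    heckeRep q (heckeT q w) (Pi.single 1 1) = Pi.single w 1 := by
  obtain ⟨a, ha⟩ := exists_isReducedDecomposition w
  rw [heckeT_eq_prod q ha]
  induction a generalizing w with
  | nil => obtain rfl : 1 = w := ha.1; simp
  | cons i a ih =>
    obtain ⟨hi, ha⟩ := isReducedDecomposition_cons.1 ha
    rw [List.map_cons, List.prod_cons, map_mul, Module.End.mul_apply, ih _ ha, heckeRep_heckeGen,
      heckeOp_single_of_not_isLeftDescent q (isLeftDescent_adjSwap_mul.not_left.2 hi),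
      adjSwap_mul_cancel]

theorem linearCombination_heckeOp (i : Fin (n - 1)) (c : Perm (Fin n) → R) :
    Fintype.linearCombination R (heckeT q) (heckeOp q i c) =
      heckeGen q n i * Fintype.linearCombination R (heckeT q) c := by
  suffices h : Fintype.linearCombination R (heckeT q) ∘ₗ heckeOp q i =
      LinearMap.mulLeft R (heckeGen q n i) ∘ₗ Fintype.linearCombination R (heckeT q) from
    LinearMap.congr_fun h c
  refine LinearMap.pi_ext' fun w => LinearMap.ext_ring ?_
  simp only [LinearMap.comp_apply, LinearMap.coe_single, LinearMap.mulLeft_apply,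
    Fintype.linearCombination_apply_single, one_smul]
  by_cases h : IsLeftDescent w i
  · rw [heckeOp_single_of_isLeftDescent q h, heckeGen_mul_heckeT_of_isLeftDescent q h]
    simp only [map_add, map_smul, Fintype.linearCombination_apply_single, one_smul]
  · rw [heckeOp_single_of_not_isLeftDescent q h, heckeGen_mul_heckeT_of_not_isLeftDescent q h,
      Fintype.linearCombination_apply_single, one_smul]

theorem linearCombination_heckeRep (x : HeckeAlgebra R q n) (c : Perm (Fin n) → R) :
    Fintype.linearCombination R (heckeT q) (heckeRep q x c) =
      x * Fintype.linearCombination R (heckeT q) c := by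
  induction x using HeckeAlgebra.induction generalizing c with
  | algebraMap r => rw [AlgHom.commutes, Module.algebraMap_end_apply, map_smul, Algebra.smul_def]
  | heckeGen i => rw [heckeRep_heckeGen, linearCombination_heckeOp]
  | mul x y hx hy => rw [map_mul, Module.End.mul_apply, hx, hy, mul_assoc]
  | add x y hx hy => rw [map_add, LinearMap.add_apply, map_add, hx, hy, add_mul]

/-- The coordinates of an element of the Hecke algebra with respect to the basis `T_w`. -/
noncomputable def heckeCoeff : HeckeAlgebra R q n ≃ₗ[R] (Perm (Fin n) → R) :=
  .symm <| .ofLinearMap (Fintype.linearCombination R (heckeT q))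
    ((heckeRep q).toLinearMap.flip (Pi.single 1 1))
    (LinearMap.ext fun x => by
      simp [linearCombination_heckeRep, heckeT_one])
    (LinearMap.pi_ext' fun w => LinearMap.ext_ring <| by
      simp [heckeRep_heckeT_single_one])

theorem heckeCoeff_heckeT (w : Perm (Fin n)) : heckeCoeff q (heckeT q w) = Pi.single w 1 :=
  heckeRep_heckeT_single_one q w

theorem heckeCoeff_heckeGen_mul (i : Fin (n - 1)) (x : HeckeAlgebra R q n) :
    heckeCoeff q (heckeGen q n i * x) = heckeOp q i (heckeCoeff q x) := by
  change heckeRep q (heckeGen q n i * x) (Pi.single 1 1) = _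
  rw [map_mul, heckeRep_heckeGen]
  rfl

theorem eq_sum_smul_heckeT_iff {x : HeckeAlgebra R q n} {c : Perm (Fin n) → R} :
    x = ∑ w, c w • heckeT q w ↔ c = heckeCoeff q x := by
  rw [eq_comm, ← Fintype.linearCombination_apply, ← LinearEquiv.symm_apply_eq]
  exact .rfl

end StandardBasis

section CycleCount

variable {α : Type*}

theorem eq_of_sameCycle_of_invariant {β : Type*} {x : Perm α} {f : α → β}
    (hf : ∀ y, f (x y) = f y) {y z : α} (h : x.SameCycle y z) : f y = f z := by
  obtain ⟨k, rfl⟩ := h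
  induction k with
  | zero => rfl
  | succ k ih => rw [add_comm, zpow_add, zpow_one, Perm.mul_apply, hf, ih]
  | pred k ih =>
    rw [ih, ← hf ((x ^ (-(k : ℤ) - 1)) y), ← Perm.mul_apply, ← zpow_one_add, add_sub_cancel]

theorem card_quotient_sameCycle_le_swap_mul [Finite α] [DecidableEq α] (a b : α) (x : Perm α) :
    Nat.card (Quotient (Perm.SameCycle.setoid x)) ≤
      Nat.card (Quotient (Perm.SameCycle.setoid (swap a b * x))) + 1 := by
  classical
  let mk : α → Quotient (Perm.SameCycle.setoid x) := Quotient.mk _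
  -- Identifying the classes of `a` and `b` makes the class map invariant under `swap a b * x`.
  let merge : α → Quotient (Perm.SameCycle.setoid x) := Function.update id (mk a) (mk b) ∘ mk
  have mk_apply (z : α) : mk (x z) = mk z :=
    Quotient.sound (Perm.sameCycle_apply_left.2 (.refl x z))
  have merge_swap (z : α) : merge (swap a b z) = merge z := by
    have hab : merge a = merge b := by
      simp only [merge, Function.comp_apply, Function.update_apply, id_eq, if_true, ite_self]
    rw [swap_apply_def]
    split_ifs with ha hb
    · rw [ha, hab]
    · rw [hb, hab]
    · rfl
  have merge_apply (z : α) : merge ((swap a b * x) z) = merge z := by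
    simp only [Perm.mul_apply, merge_swap, merge, Function.comp_apply, mk_apply]
  let g (o : Option (Quotient (Perm.SameCycle.setoid (swap a b * x)))) :
      Quotient (Perm.SameCycle.setoid x) :=
    o.elim (mk a) (Quotient.lift merge fun _ _ => eq_of_sameCycle_of_invariant merge_apply)
  have hg : Function.Surjective g := by
    rintro ⟨z⟩
    by_cases hz : mk z = mk a
    · exact ⟨none, hz.symm⟩
    · exact ⟨some (Quotient.mk _ z), Function.update_of_ne hz _ _⟩
  simpa only [Finite.card_option] using Nat.card_le_card_of_surjective g hg

variable [Fintype α] [DecidableEq α]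

/-- Sends a point to the cycle of `x` which contains it if it is moved, and to itself if it is
fixed. -/
def cycleLabel (x : Perm α) (z : α) : x.cycleFactorsFinset ⊕ {z // x z = z} :=
  if h : x z = z then .inr ⟨z, h⟩
  else .inl ⟨x.cycleOf z, Perm.cycleOf_mem_cycleFactorsFinset_iff.2 (Perm.mem_support.2 h)⟩

theorem cycleLabel_eq_iff {x : Perm α} {y z : α} :
    cycleLabel x y = cycleLabel x z ↔ x.SameCycle y z := by
  by_cases hy : x y = y <;> by_cases hz : x z = z <;> simp only [cycleLabel, hy, hz, dite_true,
    dite_false, Sum.inl.injEq, Sum.inr.injEq, Subtype.mk.injEq, reduceCtorEq, false_iff]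
  · exact ⟨fun h => h ▸ .refl x _, fun h => h.eq_of_left hy⟩
  · exact fun h => hz (h.apply_eq_self_iff.1 hy)
  · exact fun h => hy (h.apply_eq_self_iff.2 hz)
  · exact (Perm.sameCycle_iff_cycleOf_eq_of_mem_support (Perm.mem_support.2 hy)
      (Perm.mem_support.2 hz)).symm

theorem cycleLabel_surjective (x : Perm α) : Function.Surjective (cycleLabel x) := by
  rintro (⟨c, hc⟩ | ⟨z, hz⟩)
  · obtain ⟨hcycle, hcx⟩ := Perm.mem_cycleFactorsFinset_iff.1 hc
    obtain ⟨z, hz⟩ := hcycle.nonempty_support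
    have hxz : x z ≠ z := hcx z hz ▸ Perm.mem_support.1 hz
    refine ⟨z, ?_⟩
    rw [cycleLabel, dif_neg hxz, Sum.inl.injEq, Subtype.mk.injEq, Perm.cycle_is_cycleOf hz hc]
  · exact ⟨z, dif_pos hz⟩

theorem numCycles_eq_card_quotient {n : ℕ} (x : Perm (Fin n)) :
    numCycles x = Nat.card (Quotient (Perm.SameCycle.setoid x)) := by
  have hker : Setoid.ker (cycleLabel x) = Perm.SameCycle.setoid x :=
    Setoid.ext fun _ _ => cycleLabel_eq_iff
  rw [← hker, Nat.card_congr (Setoid.quotientKerEquivOfSurjective _ (cycleLabel_surjective x)),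
    Nat.card_sum, Nat.card_eq_fintype_card, Nat.card_eq_fintype_card, Fintype.card_coe,
    Fintype.card_subtype, numCycles, Perm.cycleType_def, Multiset.card_map, Finset.card_val]

end CycleCount

section NumCycles

variable {n : ℕ}

theorem numCycles_add_sum_cycleType (x : Perm (Fin n)) :
    numCycles x + x.cycleType.sum = n + x.cycleType.card := by
  have hfix : (Finset.univ.filter fun i => x i = i).card + x.cycleType.sum = n := by
    rw [Perm.sum_cycleType, Perm.support, Finset.card_filter_add_card_filter_not,
      Finset.card_univ, Fintype.card_fin]
  rw [numCycles, add_assoc, hfix, add_comm]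

theorem numCycles_eq_of_cycleType_eq {x y : Perm (Fin n)} (h : x.cycleType = y.cycleType) :
    numCycles x = numCycles y := by
  have hx := numCycles_add_sum_cycleType x
  have hy := numCycles_add_sum_cycleType y
  rw [h] at hx
  omega

theorem numCycles_inv_mul_revPerm (w : Perm (Fin n)) :
    numCycles (w⁻¹ * Fin.revPerm) = numCycles (reversal w) := by
  have h : reversal w = w * (w⁻¹ * Fin.revPerm)⁻¹ * w⁻¹ := by
    rw [mul_inv_rev, inv_inv, mul_assoc, mul_assoc, mul_inv_cancel, mul_one]
    rfl
  exact numCycles_eq_of_cycleType_eq (by rw [h, Perm.cycleType_conj, Perm.cycleType_inv])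

theorem numCycles_one : numCycles (1 : Perm (Fin n)) = n := by
  simpa using numCycles_add_sum_cycleType (1 : Perm (Fin n))

theorem sub_numCycles_inv_mul_adjSwap_mul_le (v w : Perm (Fin n)) (i : Fin (n - 1)) :
    n - numCycles (w⁻¹ * (adjSwap n i * v)) ≤ n - numCycles (w⁻¹ * v) + 1 := by
  have h : w⁻¹ * (adjSwap n i * v) = swap (w⁻¹ (adjLo i)) (w⁻¹ (adjHi i)) * (w⁻¹ * v) := by
    rw [← mul_assoc, ← mul_assoc, ← mul_swap_eq_swap_mul]
    rfl
  have := card_quotient_sameCycle_le_swap_mul (w⁻¹ (adjLo i)) (w⁻¹ (adjHi i)) (w⁻¹ * v)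
  rw [← numCycles_eq_card_quotient, ← numCycles_eq_card_quotient, ← h] at this
  omega

end NumCycles

section EvacWord

variable {n : ℕ}

theorem prod_take_finRange_apply_val {k : ℕ} (hk : k ≤ n - 1) (x : Fin n) :
    ((((List.finRange (n - 1)).take k).map (adjSwap n)).prod x : ℕ) =
      if (x : ℕ) < k then (x : ℕ) + 1 else if (x : ℕ) = k then 0 else x := by
  induction k generalizing x with
  | zero => simp
  | succ k ih =>
    rw [List.take_succ_eq_append_getElem (by simpa using hk), List.map_append, List.prod_append,
      Perm.mul_apply, ih (by omega)]
    simp only [List.getElem_finRange, List.map_cons, List.map_nil, List.prod_singleton,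
      adjSwap_val, Fin.val_cast]
    split_ifs <;> omega

theorem prod_drop_flatMap_take_apply_val {k : ℕ} (hk : k ≤ n - 1) (x : Fin n) :
    (((((List.finRange (n - 1)).drop (n - 1 - k)).flatMap fun j : Fin (n - 1) =>
      (List.finRange (n - 1)).take (n - 1 - j)).map (adjSwap n)).prod x : ℕ) =
      if (x : ℕ) ≤ k then k - (x : ℕ) else x := by
  induction k generalizing x with
  | zero =>
    rw [List.drop_of_length_le (by simp)]
    simp
  | succ k ih =>
    have hdrop : n - 1 - (k + 1) + 1 = n - 1 - k := by omega
    have htake : n - 1 - (n - 1 - (k + 1)) = k + 1 := by omega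
    rw [List.drop_eq_getElem_cons (by simp; omega), List.flatMap_cons, List.map_append,
      List.prod_append, Perm.mul_apply, List.getElem_finRange, hdrop, Fin.val_cast, htake,
      prod_take_finRange_apply_val hk, ih (by omega)]
    split_ifs <;> omega

theorem evacWord_eq_flatMap (n : ℕ) :
    evacWord n = (List.finRange (n - 1)).flatMap fun j : Fin (n - 1) =>
      (List.finRange (n - 1)).take (n - 1 - j) := by
  -- The coercion to `ℕ` in `evacWord` elaborates to a monadic lift of the whole list.
  simp only [evacWord, List.bind_eq_flatMap, List.pure_def, List.flatMap_assoc,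
    List.flatMap_singleton]

theorem prod_evacWord (n : ℕ) : ((evacWord n).map (adjSwap n)).prod = Fin.revPerm := by
  ext x
  have h := prod_drop_flatMap_take_apply_val le_rfl x
  rw [Nat.sub_self, List.drop_zero] at h
  rw [evacWord_eq_flatMap, h, Fin.revPerm_apply, Fin.val_rev]
  split_ifs <;> omega

end EvacWord

section Divisibility

variable {R : Type*} [CommRing R] {q : R} {F : Type*} [CommRing F] [Algebra R F] {n : ℕ}

/-- The image in the `R`-algebra `F` of the ideal of `R` generated by `(q - 1) ^ d`. -/
def subOnePowMultiples (q : R) (F : Type*) [CommRing F] [Algebra R F] (d : ℕ) : Submodule R F :=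
  LinearMap.range ((q - 1) ^ d • Algebra.linearMap R F)

theorem mem_subOnePowMultiples {d : ℕ} {y : F} :
    y ∈ subOnePowMultiples q F d ↔
      ∃ g : R, y = (algebraMap R F q - 1) ^ d * algebraMap R F g := by
  simp only [subOnePowMultiples, LinearMap.mem_range, LinearMap.smul_apply,
    Algebra.linearMap_apply, Algebra.smul_def, map_pow, map_sub, map_one, eq_comm (a := y)]

theorem sub_one_smul_mem_subOnePowMultiples {d e : ℕ} {y : F} (hy : y ∈ subOnePowMultiples q F d)
    (h : e ≤ d + 1) : (q - 1) • y ∈ subOnePowMultiples q F e := by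
  rw [mem_subOnePowMultiples] at hy ⊢
  obtain ⟨g, rfl⟩ := hy
  obtain ⟨k, hk⟩ := Nat.exists_eq_add_of_le h
  refine ⟨(q - 1) ^ k * g, ?_⟩
  rw [Algebra.smul_def, ← mul_assoc, map_mul, ← mul_assoc, map_pow, map_sub, map_one, ← pow_succ',
    hk, pow_add]

/-- The elements of the Hecke algebra over `F` whose coefficient at `T_w` is, for every `w`, a
multiple of `(q - 1) ^ (n - κ)`, where `κ` is the number of cycles of `w⁻¹ * v`. -/
noncomputable def cycleSubmodule (q : R) (F : Type*) [CommRing F] [Algebra R F] (v : Perm (Fin n)) :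
    Submodule R (HeckeAlgebra F (algebraMap R F q) n) :=
  (Submodule.pi Set.univ fun w => subOnePowMultiples q F (n - numCycles (w⁻¹ * v))).comap
    ((heckeCoeff (algebraMap R F q)).toLinearMap.restrictScalars R)

namespace cycleSubmodule

variable {v : Perm (Fin n)} {x : HeckeAlgebra F (algebraMap R F q) n}

theorem mem_iff : x ∈ cycleSubmodule q F v ↔ ∀ w, heckeCoeff (algebraMap R F q) x w ∈
    subOnePowMultiples q F (n - numCycles (w⁻¹ * v)) := by
  simp only [cycleSubmodule, Submodule.mem_comap, Submodule.mem_pi, Set.mem_univ, true_imp_iff]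
  rfl

theorem one_mem : 1 ∈ cycleSubmodule q F (1 : Perm (Fin n)) := by
  refine mem_iff.2 fun w => ?_
  rw [← heckeT_one, heckeCoeff_heckeT]
  by_cases hw : w = 1
  · refine mem_subOnePowMultiples.2 ⟨1, ?_⟩
    rw [hw, Pi.single_eq_same, inv_one, one_mul, numCycles_one, Nat.sub_self, pow_zero, one_mul,
      map_one]
  · rw [Pi.single_eq_of_ne hw]
    exact zero_mem _

theorem sub_one_smul_mem (hx : x ∈ cycleSubmodule q F v) (i : Fin (n - 1)) :
    (q - 1) • x ∈ cycleSubmodule q F (adjSwap n i * v) := by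
  refine mem_iff.2 fun w => ?_
  have h := sub_one_smul_mem_subOnePowMultiples (mem_iff.1 hx w)
    (sub_numCycles_inv_mul_adjSwap_mul_le v w i)
  rwa [← algebraMap_smul F, map_smul, Pi.smul_apply, algebraMap_smul]

theorem heckeGen_mul_mem (hx : x ∈ cycleSubmodule q F v) (i : Fin (n - 1)) :
    heckeGen (algebraMap R F q) n i * x ∈ cycleSubmodule q F (adjSwap n i * v) := by
  refine mem_iff.2 fun w => ?_
  have hswap := mem_iff.1 hx (adjSwap n i * w)
  rw [mul_inv_rev, adjSwap_inv, mul_assoc] at hswap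
  have hself := sub_one_smul_mem_subOnePowMultiples (mem_iff.1 hx w)
    (sub_numCycles_inv_mul_adjSwap_mul_le v w i)
  rw [heckeCoeff_heckeGen_mul, heckeOp_apply, ← map_one (algebraMap R F), ← map_sub,
    ← Algebra.smul_def, ← Algebra.smul_def]
  split_ifs
  · exact add_mem hswap hself
  · exact Submodule.smul_mem _ q hswap

theorem prod_mem {t : Fin (n - 1) → HeckeAlgebra F (algebraMap R F q) n}
    (ht : ∀ i, t i ∈ Submodule.span R {(q - 1) • 1, heckeGen (algebraMap R F q) n i})
    (a : List (Fin (n - 1))) : (a.map t).prod ∈ cycleSubmodule q F (a.map (adjSwap n)).prod := by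
  induction a with
  | nil => exact one_mem
  | cons i a ih =>
    obtain ⟨r, s, hrs⟩ := Submodule.mem_span_pair.1 (ht i)
    rw [List.map_cons, List.prod_cons, List.map_cons, List.prod_cons, ← hrs, add_mul,
      smul_mul_assoc, smul_mul_assoc, smul_mul_assoc, one_mul]
    exact add_mem (Submodule.smul_mem _ r (sub_one_smul_mem ih i))
      (Submodule.smul_mem _ s (heckeGen_mul_mem ih i))

end cycleSubmodule

theorem prod_map_heckeE {F : Type*} [Field F] (q : F) (a : List (Fin (n - 1))) :
    (a.map (heckeE q n)).prod = (q + 1)⁻¹ ^ a.length •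
      (a.map fun i => algebraMap F (HeckeAlgebra F q n) (q - 1) - 2 * heckeGen q n i).prod := by
  rw [← List.length_map, List.smul_prod, List.map_map]
  rfl

theorem exists_heckeCoeff_prod_heckeE_eq {F : Type*} [Field F] [Algebra R F]
    (a : List (Fin (n - 1))) (w : Perm (Fin n)) :
    ∃ g : R, heckeCoeff (algebraMap R F q) (a.map (heckeE (algebraMap R F q) n)).prod w =
      (algebraMap R F q - 1) ^ (n - numCycles (w⁻¹ * (a.map (adjSwap n)).prod)) *
        (algebraMap R F g / (algebraMap R F q + 1) ^ a.length) := by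
  have hspan (i : Fin (n - 1)) : algebraMap F (HeckeAlgebra F (algebraMap R F q) n)
      (algebraMap R F q - 1) - 2 * heckeGen (algebraMap R F q) n i ∈
        Submodule.span R {(q - 1) • 1, heckeGen (algebraMap R F q) n i} := by
    have hq : algebraMap F (HeckeAlgebra F (algebraMap R F q) n) (algebraMap R F q - 1) =
        (q - 1) • 1 := by
      rw [← map_one (algebraMap R F), ← map_sub, ← IsScalarTower.algebraMap_apply]
      exact Algebra.algebraMap_eq_smul_one _
    rw [hq, two_mul, ← two_smul R]
    exact sub_mem (Submodule.subset_span (.inl rfl))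
      (Submodule.smul_mem _ 2 (Submodule.subset_span (.inr rfl)))
  obtain ⟨g, hg⟩ := mem_subOnePowMultiples.1
    (cycleSubmodule.mem_iff.1 (cycleSubmodule.prod_mem hspan a) w)
  refine ⟨g, ?_⟩
  rw [prod_map_heckeE, map_smul, Pi.smul_apply, hg, smul_eq_mul, inv_pow, mul_left_comm,
    mul_comm _⁻¹, div_eq_mul_inv]

end Divisibility

theorem theorem5p2_general (K : Type*) [CommRing K] [IsDomain K] (n : ℕ)
    (a : List (Fin (n - 1))) :
    (∃! c : Perm (Fin n) → RatFunc K,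
      (a.map (heckeE (RatFunc.X : RatFunc K) n)).prod =
        ∑ w, c w • heckeT (RatFunc.X : RatFunc K) w) ∧
    ∀ c : Perm (Fin n) → RatFunc K,
      (a.map (heckeE (RatFunc.X : RatFunc K) n)).prod =
        ∑ w, c w • heckeT (RatFunc.X : RatFunc K) w →
      ∀ w, ∃ (g : Polynomial K) (N : ℕ),
        c w = (RatFunc.X - 1) ^ (n - numCycles (w⁻¹ * (a.map (adjSwap n)).prod)) *
          (algebraMap (Polynomial K) (RatFunc K) g / (RatFunc.X + 1) ^ N) := by
  simp only [eq_sum_smul_heckeT_iff, existsUnique_eq, true_and, forall_eq]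
  intro w
  obtain ⟨g, hg⟩ := exists_heckeCoeff_prod_heckeE_eq (R := Polynomial K) (q := Polynomial.X)
    (F := RatFunc K) a w
  rw [RatFunc.algebraMap_X] at hg
  exact ⟨g, a.length, hg⟩

theorem theorem5p2 (K : Type*) [Field K] [CharZero K] (n : ℕ) :
    (∃! c : Equiv.Perm (Fin n) → RatFunc K, IsEvacExpansion (RatFunc.X : RatFunc K) n c) ∧
    ∀ c : Equiv.Perm (Fin n) → RatFunc K, IsEvacExpansion (RatFunc.X : RatFunc K) n c →
      ∀ w : Equiv.Perm (Fin n), ∃ (g : Polynomial K) (N : ℕ),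
        c w = (RatFunc.X - 1) ^ (n - numCycles (reversal w)) *
          (algebraMap (Polynomial K) (RatFunc K) g / (RatFunc.X + 1) ^ N) := by
  simpa only [IsEvacExpansion, evacProduct, prod_evacWord, numCycles_inv_mul_revPerm] using
    theorem5p2_general K n (evacWord n)
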